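/- Conventions. Fix a precision $p\in\mathbb N$. A floating-point number of precision $p$ is a real number of the form $m\cdot 10^{\alpha}$ with $\alpha\in\mathbb Z$, where $m$ is a (signed) decimal number with $p$ digits after the decimal point and either $m=0$ or $|m|\in[0.1,1)$. The digits of a real number $x\neq 0$ are those of its mantissa, i.e. of the number $x/10^{e}$ with $e\in\mathbb Z$ chosen such that $|x|/10^{e}\in[0.1,1)$. A floating-point rounding function of precision $p$ is a map $[\cdot]:\mathbb R\to\mathbb R$ such that $[x]$ is a floating-point number of precision $p$ that is closest to the number obtained from $x$ by keeping only the first $p+1$ digits of its mantissa, ties being broken in any fixed way for which the following hold: there is $c>0$ with $|x|/c\le|[x]|\le c|x|$ for all $x$; $[10^{\alpha}x]=10^{\alpha}[x]$ for all $\alpha\in\mathbb Z$ and all $x$; $[x]=[x']$ whenever $x$ and $x'$ have the same sign, the same exponent $e$ and the same first $p+1$ digits; and $\operatorname{sign}([x])=\operatorname{sign}(x)$. The rounding is applied to vectors componentwise. Theorem. Let $[\cdot]$ be a floating-point rounding function of precision $p$, let $M\in\mathbb Q^{d\times d}$ and $x\in\mathbb Q^{d}$ have only non-negative entries, and let $(x^{(t)})_{t\in\mathbb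 N}$ be the rounded orbit of the linear dynamical system $(M,x)$, i.e. $x^{(0)}=[x]$ and $x^{(t)}=[Mx^{(t-1)}]$ for $t\ge 1$. Let $Y\subseteq\mathbb R^{d}$ be a semialgebraic set, i.e. a finite Boolean combination of polynomial inequalities with real coefficients. Then the set of hitting times $\mathcal Z(Y)=\{t\in\mathbb N : x^{(t)}\in Y\}$ is semi-linear: there are finite sets $F,B\subseteq\mathbb N$ and $q\in\mathbb N$ such that $\mathcal Z(Y)=F\cup\bigcup_{b\in B}\{b+kq : k\in\mathbb N\}$. Equivalently, $\mathcal Z(Y)$ is eventually periodic: there are $N\in\mathbb N$ and $q\ge 1$ such that for all $t\ge N$, $t+q\in\mathcal Z(Y)$ if and only if $t\in\mathcal Z(Y)$. -/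

import Mathlib

/-- The exponent of a non-zero real `x` in base ten: the integer `e` such that
`10 ^ (e - 1) ≤ |x| < 10 ^ e`, so that the mantissa `x / 10 ^ e` has absolute value in
`[0.1, 1)`. The value at `x = 0` is irrelevant, since the mantissa is then `0`. -/
noncomputable def decExponent (x : ℝ) : ℤ := Int.log 10 |x| + 1

/-- The mantissa of `x`: it is `0` if `x = 0`, and otherwise has absolute value in `[0.1, 1)` and
satisfies `x = decMantissa x * 10 ^ decExponent x`. -/
noncomputable def decMantissa (x : ℝ) : ℝ := x / (10 : ℝ) ^ decExponent x

/-- The real number obtained from `x` by keeping only the first `n` digits (after the decimal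
point) of its mantissa, together with its sign and exponent. -/
noncomputable def keepDigits (n : ℕ) (x : ℝ) : ℝ :=
  (SignType.sign x : ℝ) * ((⌊|decMantissa x| * 10 ^ n⌋ : ℤ) : ℝ) / 10 ^ n *
    (10 : ℝ) ^ decExponent x

/-- `y` is a floating-point number of precision `p` in base ten: `y = m * 10 ^ α` where `α` is an
integer and `m`, up to its sign, is a decimal number in `{0} ∪ [0.1, 1)` with `p` digits after the
decimal point. -/
def IsFloatingPoint (p : ℕ) (y : ℝ) : Prop :=
  ∃ (m : ℝ) (α : ℤ), (∃ k : ℤ, m = k / 10 ^ p) ∧ (m = 0 ∨ (1 / 10 ≤ |m| ∧ |m| < 1)) ∧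
    y = m * (10 : ℝ) ^ α

/-- `r` is a floating-point rounding function of precision `p` in base ten: `r x` is a
floating-point number of precision `p` closest to the number given by the first `p + 1` digits of
`x`, where ties are broken in any way that makes `r` log-bounded, mantissa-based, `p + 1`-finite
and sign preserving. -/
structure IsRounding (p : ℕ) (r : ℝ → ℝ) : Prop where
  isFloatingPoint : ∀ x, IsFloatingPoint p (r x)
  closest : ∀ x y, IsFloatingPoint p y →
    |r x - keepDigits (p + 1) x| ≤ |y - keepDigits (p + 1) x|
  logBounded : ∃ c : ℝ, 0 < c ∧ ∀ x, |x| / c ≤ |r x| ∧ |r x| ≤ c * |x|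
  mantissaBased : ∀ (α : ℤ) (x : ℝ), r ((10 : ℝ) ^ α * x) = (10 : ℝ) ^ α * r x
  finite : ∀ x x', keepDigits (p + 1) x = keepDigits (p + 1) x' → r x = r x'
  signPreserving : ∀ x, SignType.sign (r x) = SignType.sign x

/-- The rounded orbit of the linear dynamical system `(M, x)`: every component of the initial
vector is rounded, and each further vector is the exact product of `M` with its predecessor, with
every component of the result rounded. -/
noncomputable def roundedOrbit {d : ℕ} (r : ℝ → ℝ) (M : Matrix (Fin d) (Fin d) ℚ)
    (x : Fin d → ℚ) : ℕ → Fin d → ℝ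
  | 0 => fun i => r (x i : ℝ)
  | t + 1 => fun i => r (∑ j, (M i j : ℝ) * roundedOrbit r M x t j)

/-- A semialgebraic subset of `ℝ ^ d`: a finite Boolean combination of (weak or strict) polynomial
inequalities. -/
inductive IsSemialgebraic {d : ℕ} : Set (Fin d → ℝ) → Prop
  | nonneg (P : MvPolynomial (Fin d) ℝ) : IsSemialgebraic {v | 0 ≤ MvPolynomial.eval v P}
  | pos (P : MvPolynomial (Fin d) ℝ) : IsSemialgebraic {v | 0 < MvPolynomial.eval v P}
  | compl {A : Set (Fin d → ℝ)} : IsSemialgebraic A → IsSemialgebraic Aᶜ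
  | inter {A B : Set (Fin d → ℝ)} : IsSemialgebraic A → IsSemialgebraic B → IsSemialgebraic (A ∩ B)
  | union {A B : Set (Fin d → ℝ)} : IsSemialgebraic A → IsSemialgebraic B → IsSemialgebraic (A ∪ B)

/-- The set of hitting times of the target `Y` by a sequence of vectors. -/
def hittingTimes {d : ℕ} (u : ℕ → Fin d → ℝ) (Y : Set (Fin d → ℝ)) : Set ℕ := {t | u t ∈ Y}

/-- A one-dimensional semi-linear set: the union of a finite set `F` and of finitely many linear
sets `{b + k * q | k ∈ ℕ}`, `b ∈ B`, with a common period `q`. -/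
def IsSemilinear (X : Set ℕ) : Prop :=
  ∃ (F B : Finset ℕ) (q : ℕ), ∀ t, t ∈ X ↔ t ∈ F ∨ ∃ b ∈ B, ∃ k : ℕ, t = b + k * q

/-- Membership in `X` is eventually periodic. -/
def IsEventuallyPeriodic (X : Set ℕ) : Prop :=
  ∃ N q : ℕ, 0 < q ∧ ∀ t, N ≤ t → (t + q ∈ X ↔ t ∈ X)

/-! Non-negativity excludes cancellation. Hence, up to constant factors, the rounded dynamics
follows the exact one, and a rounded value does not react to relatively small changes of its inputs
(`exists_rounding_add_eq`, abstracted in `RoundedSystem.stable`). Rounding commutes with powers of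
ten, and only finitely many floats lie in a bounded interval away from zero, so comparable
coordinates must repeat up to a common power of ten.

Pass to a power of the matrix in which every coordinate on a cycle has a loop
(`exists_aperiodic_pow`) and induct along reachability, showing that each coordinate is eventually
multiplied by a fixed power of ten every `q` steps. Without a loop, the fastest-growing inputs
decide (`regular_of_inputs`). With a loop, the strongly connected class consists of mutually
comparable coordinates; pigeonhole yields a repetition of the class, together with one
non-negligible upstream coordinate if there is any, and it persists because all inputs not repeating
along are negligible (`regular_of_loop`).

Along a suitable arithmetic progression of times a polynomial in the coordinates is then a Laurent
polynomial in `10 ^ s`, whose sign is eventually constant. -/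

namespace RoundedLDS

section Periodicity

open Filter

/-! ### Eventually periodic sets of natural numbers -/

theorem mem_add_mul_iff {X : Set ℕ} {N q : ℕ} (h : ∀ t, N ≤ t → (t + q ∈ X ↔ t ∈ X)) (k : ℕ) {t : ℕ}
    (ht : N ≤ t) : t + k * q ∈ X ↔ t ∈ X := by
  induction k with
  | zero => simp
  | succ k ih =>
    rw [← ih, ← h (t + k * q) (by omega)]
    congr! 1
    ring

theorem isSemilinear_of_isEventuallyPeriodic {X : Set ℕ} (h : IsEventuallyPeriodic X) :
    IsSemilinear X := by
  classical
  obtain ⟨N, q, hq, h⟩ := h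
  refine ⟨(Finset.range N).filter (· ∈ X), (Finset.Ico N (N + q)).filter (· ∈ X), q,
    fun t => ⟨fun ht => ?_, ?_⟩⟩
  · by_cases htN : t < N
    · exact Or.inl (by simp [htN, ht])
    · have hdiv := Nat.mod_add_div (t - N) q
      have hlt := Nat.mod_lt (t - N) hq
      have e : t = N + (t - N) % q + (t - N) / q * q := by
        rw [mul_comm]; omega
      refine Or.inr ⟨N + (t - N) % q, ?_, (t - N) / q, e⟩
      rw [Finset.mem_filter, Finset.mem_Ico]
      refine ⟨⟨by omega, by omega⟩, ?_⟩
      rw [e] at ht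
      exact (mem_add_mul_iff h _ (by omega)).1 ht
  · rintro (ht | ⟨b, hb, k, rfl⟩)
    · exact (Finset.mem_filter.1 ht).2
    · rw [Finset.mem_filter, Finset.mem_Ico] at hb
      exact (mem_add_mul_iff h k hb.1.1).2 hb.2

theorem isEventuallyPeriodic_compl {X : Set ℕ} (h : IsEventuallyPeriodic X) :
    IsEventuallyPeriodic Xᶜ := by
  obtain ⟨N, q, hq, h⟩ := h
  exact ⟨N, q, hq, fun t ht => not_congr (h t ht)⟩

theorem exists_common_period {X Y : Set ℕ} (hX : IsEventuallyPeriodic X)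
    (hY : IsEventuallyPeriodic Y) : ∃ N q : ℕ, 0 < q ∧
      ∀ t, N ≤ t → ((t + q ∈ X ↔ t ∈ X) ∧ (t + q ∈ Y ↔ t ∈ Y)) := by
  obtain ⟨N, q, hq, h⟩ := hX
  obtain ⟨N', q', hq', h'⟩ := hY
  refine ⟨max N N', q' * q, Nat.mul_pos hq' hq, fun t ht => ⟨?_, ?_⟩⟩
  · exact mem_add_mul_iff h q' (le_trans (le_max_left _ _) ht)
  · rw [mul_comm]
    exact mem_add_mul_iff h' q (le_trans (le_max_right _ _) ht)

theorem isEventuallyPeriodic_inter {X Y : Set ℕ} (hX : IsEventuallyPeriodic X)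
    (hY : IsEventuallyPeriodic Y) : IsEventuallyPeriodic (X ∩ Y) := by
  obtain ⟨N, q, hq, h⟩ := exists_common_period hX hY
  exact ⟨N, q, hq, fun t ht => and_congr (h t ht).1 (h t ht).2⟩

theorem isEventuallyPeriodic_union {X Y : Set ℕ} (hX : IsEventuallyPeriodic X)
    (hY : IsEventuallyPeriodic Y) : IsEventuallyPeriodic (X ∪ Y) := by
  obtain ⟨N, q, hq, h⟩ := exists_common_period hX hY
  exact ⟨N, q, hq, fun t ht => or_congr (h t ht).1 (h t ht).2⟩

theorem isEventuallyPeriodic_of_shift {X : Set ℕ} (N : ℕ)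
    (h : IsEventuallyPeriodic {s | N + s ∈ X}) : IsEventuallyPeriodic X := by
  obtain ⟨N', q, hq, h⟩ := h
  refine ⟨N + N', q, hq, fun t ht => ?_⟩
  obtain ⟨u, rfl⟩ := Nat.exists_eq_add_of_le (show N ≤ t by omega)
  simpa [add_assoc] using h u (by omega)

theorem isEventuallyPeriodic_of_residues {X : Set ℕ} {D : ℕ} (hD : 0 < D)
    (h : ∀ ρ, ρ < D → IsEventuallyPeriodic {s | ρ + D * s ∈ X}) : IsEventuallyPeriodic X := by
  classical
  have h' : ∀ ρ : Fin D, IsEventuallyPeriodic {s | (ρ : ℕ) + D * s ∈ X} := fun ρ => h ρ ρ.2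
  choose N q hq h' using h'
  -- Beyond this threshold `t / D` exceeds every `N ρ`, and the product is a multiple of every
  -- period `q ρ`.
  refine ⟨D * (∑ ρ, N ρ) + D, D * ∏ ρ, q ρ,
    Nat.mul_pos hD (Finset.prod_pos fun ρ _ => hq ρ), fun t ht => ?_⟩
  have hlt := Nat.mod_lt t hD
  have hdiv := Nat.mod_add_div t D
  set ρ : Fin D := ⟨t % D, hlt⟩
  obtain ⟨k, hk⟩ : q ρ ∣ ∏ ρ, q ρ := Finset.dvd_prod_of_mem q (Finset.mem_univ ρ)
  have hN : N ρ ≤ ∑ ρ, N ρ := Finset.single_le_sum (f := N) (fun _ _ => Nat.zero_le _)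
    (Finset.mem_univ ρ)
  have hs : N ρ ≤ t / D := by
    refine hN.trans ((Nat.le_div_iff_mul_le hD).2 ?_)
    rw [mul_comm]; omega
  have := mem_add_mul_iff (h' ρ) k hs
  simp only [Set.mem_ofPred_eq] at this
  have e1 : (ρ : ℕ) + D * (t / D) = t := hdiv
  have e2 : (ρ : ℕ) + D * (t / D + k * q ρ) = t + D * ∏ ρ, q ρ := by
    rw [mul_add, ← add_assoc, e1, hk, mul_comm k]
  rwa [e1, e2] at this

theorem isEventuallyPeriodic_of_eventually_const {X : Set ℕ} {P : Prop}
    (h : ∀ᶠ s in atTop, (s ∈ X ↔ P)) : IsEventuallyPeriodic X := by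
  obtain ⟨N, h⟩ := eventually_atTop.1 h
  exact ⟨N, 1, one_pos, fun t ht => (h _ (by omega)).trans (h t ht).symm⟩

/-! ### Polynomials along geometric sequences -/

theorem eventually_sign_eval (R : Polynomial ℝ) :
    ∀ᶠ w in atTop, SignType.sign (R.eval w) = SignType.sign R.leadingCoeff := by
  have pos : ∀ R : Polynomial ℝ, 0 < R.leadingCoeff → ∀ᶠ w in atTop, 0 < R.eval w := by
    intro R hR
    by_cases hd : 0 < R.degree
    · exact (R.tendsto_atTop_of_leadingCoeff_nonneg hd hR.le).eventually_gt_atTop 0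
    · rw [Polynomial.eq_C_of_degree_le_zero (not_lt.1 hd)] at hR ⊢
      exact Eventually.of_forall fun w => by simpa using hR
  rcases lt_trichotomy R.leadingCoeff 0 with h | h | h
  · have := pos (-R) (by simpa using h)
    filter_upwards [this] with w hw
    rw [sign_neg h, sign_neg]
    simpa using hw
  · rw [Polynomial.leadingCoeff_eq_zero] at h
    simp [h]
  · filter_upwards [pos R h] with w hw
    rw [sign_pos h, sign_pos hw]

/-- `f s` is a Laurent polynomial in `10 ^ s`. -/
def IsLaurentSeq (f : ℕ → ℝ) : Prop :=
  ∃ (R : Polynomial ℝ) (m : ℕ), ∀ s : ℕ, f s * ((10 : ℝ) ^ s) ^ m = R.eval ((10 : ℝ) ^ s)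

theorem IsLaurentSeq.add {f g : ℕ → ℝ} (hf : IsLaurentSeq f) (hg : IsLaurentSeq g) :
    IsLaurentSeq fun s => f s + g s := by
  obtain ⟨R, m, h⟩ := hf
  obtain ⟨R', m', h'⟩ := hg
  refine ⟨R * Polynomial.X ^ m' + R' * Polynomial.X ^ m, m + m', fun s => ?_⟩
  simp only [Polynomial.eval_add, Polynomial.eval_mul, Polynomial.eval_pow, Polynomial.eval_X,
    ← h, ← h']
  ring

theorem IsLaurentSeq.mul {f g : ℕ → ℝ} (hf : IsLaurentSeq f) (hg : IsLaurentSeq g) :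
    IsLaurentSeq fun s => f s * g s := by
  obtain ⟨R, m, h⟩ := hf
  obtain ⟨R', m', h'⟩ := hg
  refine ⟨R * R', m + m', fun s => ?_⟩
  simp only [Polynomial.eval_mul, ← h, ← h']
  ring

theorem isLaurentSeq_const (c : ℝ) : IsLaurentSeq fun _ => c :=
  ⟨Polynomial.C c, 0, by simp⟩

theorem isLaurentSeq_zpow (c : ℝ) (a : ℤ) : IsLaurentSeq fun s => ((10 : ℝ) ^ a) ^ s * c := by
  obtain ⟨n, rfl | rfl⟩ := a.eq_nat_or_neg
  · refine ⟨Polynomial.X ^ n * Polynomial.C c, 0, fun s => ?_⟩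
    dsimp only
    rw [zpow_natCast, pow_right_comm, pow_zero, mul_one, Polynomial.eval_mul,
      Polynomial.eval_pow, Polynomial.eval_X, Polynomial.eval_C]
  · refine ⟨Polynomial.C c, n, fun s => ?_⟩
    have h : ((10 : ℝ) ^ n) ^ s ≠ 0 := by positivity
    rw [← pow_mul, mul_comm s n, pow_mul]
    dsimp only
    rw [zpow_neg, zpow_natCast, inv_pow, Polynomial.eval_C]
    field_simp

theorem isLaurentSeq_eval {d : ℕ} (P : MvPolynomial (Fin d) ℝ) {z : ℕ → Fin d → ℝ}
    (hz : ∀ i, IsLaurentSeq fun s => z s i) :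
    IsLaurentSeq fun s => MvPolynomial.eval (z s) P := by
  induction P using MvPolynomial.induction_on with
  | C c => simpa using isLaurentSeq_const c
  | add P Q hP hQ => simpa using hP.add hQ
  | mul_X P i hP => simpa using hP.mul (hz i)

theorem IsLaurentSeq.eventually_sign {f : ℕ → ℝ} (hf : IsLaurentSeq f) :
    ∃ σ : SignType, ∀ᶠ s in atTop, SignType.sign (f s) = σ := by
  obtain ⟨R, m, h⟩ := hf
  refine ⟨SignType.sign R.leadingCoeff, ?_⟩
  have := (tendsto_pow_atTop_atTop_of_one_lt (by norm_num : (1 : ℝ) < 10)).eventually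
    (eventually_sign_eval R)
  filter_upwards [this] with s hs
  rw [← hs, ← h, sign_mul, sign_pos (by positivity : (0 : ℝ) < ((10 : ℝ) ^ s) ^ m), mul_one]

theorem isEventuallyPeriodic_hittingTimes_of_isLaurentSeq {d : ℕ} {z : ℕ → Fin d → ℝ}
    (hz : ∀ i, IsLaurentSeq fun s => z s i) {Y : Set (Fin d → ℝ)} (hY : IsSemialgebraic Y) :
    IsEventuallyPeriodic (hittingTimes z Y) := by
  induction hY with
  | nonneg P =>
    obtain ⟨σ, h⟩ := (isLaurentSeq_eval P hz).eventually_sign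
    refine isEventuallyPeriodic_of_eventually_const (P := 0 ≤ σ) ?_
    filter_upwards [h] with s hs
    rw [← hs, sign_nonneg_iff]
    rfl
  | pos P =>
    obtain ⟨σ, h⟩ := (isLaurentSeq_eval P hz).eventually_sign
    refine isEventuallyPeriodic_of_eventually_const (P := σ = 1) ?_
    filter_upwards [h] with s hs
    rw [← hs, sign_eq_one_iff]
    rfl
  | compl _ h => exact isEventuallyPeriodic_compl h
  | inter _ _ h h' => exact isEventuallyPeriodic_inter h h'
  | union _ _ h h' => exact isEventuallyPeriodic_union h h'

/-! ### Sequences that are eventually scaled by powers of ten -/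

/-- Eventually, `f` is multiplied by `10 ^ a` every `q` steps. -/
def ScaledBy (q : ℕ) (a : ℤ) (f : ℕ → ℝ) : Prop :=
  ∀ᶠ s in atTop, f (s + q) = (10 : ℝ) ^ a * f s

theorem mul_zpow_of_step {f : ℕ → ℝ} {q N : ℕ} {a : ℤ}
    (h : ∀ s, N ≤ s → f (s + q) = (10 : ℝ) ^ a * f s) (m : ℕ) {s : ℕ} (hs : N ≤ s) :
    f (s + q * m) = ((10 : ℝ) ^ a) ^ m * f s := by
  induction m with
  | zero => simp
  | succ m ih =>
    rw [mul_add, mul_one, ← add_assoc, h _ (by omega), ih, pow_succ']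
    ring

theorem ScaledBy.mul {f : ℕ → ℝ} {q : ℕ} {a : ℤ} (h : ScaledBy q a f) (m : ℕ) :
    ScaledBy (q * m) (a * m) f := by
  obtain ⟨N, h⟩ := eventually_atTop.1 h
  filter_upwards [eventually_ge_atTop N] with s hs
  rw [mul_zpow_of_step h m hs, zpow_mul, zpow_natCast]

theorem exists_common_scale {ι : Type*} [Finite ι] {z : ℕ → ι → ℝ} {U : Set ι}
    (h : ∀ i ∈ U, ∃ q, 0 < q ∧ ∃ a, ScaledBy q a fun s => z s i) :
    ∃ q, 0 < q ∧ ∃ a : ι → ℤ, ∀ i ∈ U, ScaledBy q (a i) fun s => z s i := by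
  classical
  cases nonempty_fintype ι
  choose! q hq a ha using h
  -- Outside `U` nothing is known about `q i`; the value 1 keeps the product positive.
  set q' : ι → ℕ := fun i => if i ∈ U then q i else 1 with hq'
  have hdvd : ∀ i, q' i ∣ ∏ i, q' i := fun i => Finset.dvd_prod_of_mem q' (Finset.mem_univ i)
  choose m hm using hdvd
  refine ⟨∏ i, q' i, Finset.prod_pos fun i _ => ?_, fun i => a i * m i, fun i hi => ?_⟩
  · by_cases hi : i ∈ U
    · simpa [hq', hi] using hq i hi
    · simp [hq', hi]
  · have e : ∏ i, q' i = q i * m i := by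
      rw [hm i]; simp [hq', hi]
    rw [e]
    exact (ha i hi).mul (m i)

theorem isEventuallyPeriodic_hittingTimes_of_scaledBy {d : ℕ} {z : ℕ → Fin d → ℝ}
    (hz : ∀ i, ∃ q, 0 < q ∧ ∃ a, ScaledBy q a fun s => z s i) {Y : Set (Fin d → ℝ)}
    (hY : IsSemialgebraic Y) : IsEventuallyPeriodic (hittingTimes z Y) := by
  obtain ⟨q, hq, a, h⟩ := exists_common_scale (U := Set.univ) fun i _ => hz i
  have h' : ∀ᶠ s in atTop, ∀ i, z (s + q) i = (10 : ℝ) ^ a i * z s i :=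
    eventually_all.2 fun i => h i trivial
  obtain ⟨N, h'⟩ := eventually_atTop.1 h'
  refine isEventuallyPeriodic_of_shift N (isEventuallyPeriodic_of_residues hq fun ρ _ => ?_)
  refine isEventuallyPeriodic_hittingTimes_of_isLaurentSeq (z := fun s => z (N + (ρ + q * s)))
    (fun i => ?_) hY
  convert isLaurentSeq_zpow (z (N + ρ) i) (a i) using 2 with s
  rw [← add_assoc]
  exact mul_zpow_of_step (f := fun s => z s i) (fun s hs => h' s hs i) s (by omega)

/-- The rates are integers, so `f / g` drops by a factor of at least ten every `q` steps; only `q`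
starting points have to be considered. -/
theorem eventually_le_mul_of_rate_lt {f g : ℕ → ℝ} {q : ℕ} (hq : 0 < q) {a b : ℤ} (hab : a < b)
    (hf : ScaledBy q a f) (hg : ScaledBy q b g) (hf0 : ∀ s, 0 ≤ f s)
    (hg0 : ∀ᶠ s in atTop, 0 < g s) {ε : ℝ} (hε : 0 < ε) : ∀ᶠ s in atTop, f s ≤ ε * g s := by
  obtain ⟨N, h⟩ := eventually_atTop.1 (hf.and (hg.and hg0))
  have step : ∀ s, N ≤ s → f (s + q) / g (s + q) ≤ 1 / 10 * (f s / g s) := by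
    intro s hs
    obtain ⟨h1, h2, h3⟩ := h s hs
    rw [h1, h2, mul_div_mul_comm, ← zpow_sub₀ (by norm_num)]
    refine mul_le_mul_of_nonneg_right ?_ (div_nonneg (hf0 s) h3.le)
    calc (10 : ℝ) ^ (a - b) ≤ 10 ^ (-1 : ℤ) := zpow_le_zpow_right₀ (by norm_num) (by omega)
      _ = 1 / 10 := by norm_num
  have iter : ∀ m s, N ≤ s → f (s + q * m) / g (s + q * m) ≤ (1 / 10) ^ m * (f s / g s) := by
    intro m
    induction m with
    | zero => simp
    | succ m ih =>
      intro s hs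
      have := step (s + q * m) (by omega)
      rw [mul_add, mul_one, ← add_assoc, pow_succ', mul_assoc]
      exact this.trans (mul_le_mul_of_nonneg_left (ih s hs) (by norm_num))
  have tail : ∀ k, ∀ᶠ m : ℕ in atTop, (1 / 10 : ℝ) ^ m * (f (N + k) / g (N + k)) ≤ ε := by
    intro k
    have := (tendsto_pow_atTop_nhds_zero_of_lt_one (by norm_num : (0 : ℝ) ≤ 1 / 10)
      (by norm_num)).mul_const (f (N + k) / g (N + k))
    rw [zero_mul] at this
    exact this.eventually (eventually_le_nhds hε)
  have tail' : ∀ᶠ m : ℕ in atTop, ∀ k ∈ Finset.range q,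
      (1 / 10 : ℝ) ^ m * (f (N + k) / g (N + k)) ≤ ε :=
    (Finset.eventually_all _).2 fun k _ => tail k
  obtain ⟨m₀, hm₀⟩ := eventually_atTop.1 tail'
  filter_upwards [eventually_ge_atTop (N + q * m₀)] with s hs
  have hlt := Nat.mod_lt (s - N) hq
  have hdiv := Nat.mod_add_div (s - N) q
  have hge : m₀ ≤ (s - N) / q := by
    rw [Nat.le_div_iff_mul_le hq, mul_comm]; omega
  have e : N + (s - N) % q + q * ((s - N) / q) = s := by omega
  have := (iter ((s - N) / q) (N + (s - N) % q) (by omega)).trans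
    (hm₀ _ hge _ (Finset.mem_range.2 hlt))
  rw [e] at this
  exact (div_le_iff₀ (h s (by omega)).2.2).1 this

end Periodicity

/-! ### Rounded non-negative systems: composition and iteration -/

section System

open Filter Matrix

/-- A set of non-negative reals, invariant under powers of ten and finite in each bounded interval
away from zero. -/
structure IsScaleSet (Φ : Set ℝ) : Prop where
  nonneg : ∀ y ∈ Φ, 0 ≤ y
  scale : ∀ (α : ℤ), ∀ y ∈ Φ, (10 : ℝ) ^ α * y ∈ Φ
  finite : ∀ a b : ℝ, 0 < a → (Φ ∩ Set.Icc a b).Finite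

variable {ι : Type*} [Fintype ι]

/-- A map `G` on vectors with entries in `Φ` that agrees with the non-negative linear map `A` up to
a constant factor, commutes with powers of ten, and is insensitive to perturbations `v` whose
contribution is small relative to the value. -/
structure RoundedSystem (Φ : Set ℝ) (A : Matrix ι ι ℝ) (G : (ι → ℝ) → ι → ℝ) : Prop where
  mem : ∀ x, (∀ i, x i ∈ Φ) → ∀ i, G x i ∈ Φ
  coeff_nonneg : ∀ i j, 0 ≤ A i j
  homog : ∀ (α : ℤ) (x : ι → ℝ), G ((10 : ℝ) ^ α • x) = (10 : ℝ) ^ α • G x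
  bound : ∃ c : ℝ, 0 < c ∧ ∀ x, (∀ i, x i ∈ Φ) → ∀ i,
    (A *ᵥ x) i ≤ c * G x i ∧ G x i ≤ c * (A *ᵥ x) i
  stable : ∃ ε : ℝ, 0 < ε ∧ ∀ x x' v : ι → ℝ, (∀ i, x i ∈ Φ) → (∀ i, x' i ∈ Φ) → (∀ i, 0 ≤ v i) →
    (∀ j, x j = x' j ∨ (x j ≤ v j ∧ x' j ≤ v j)) →
    ∀ i, (A *ᵥ v) i ≤ ε * (A *ᵥ x) i → G x i = G x' i

theorem mulVec_le_mulVec {A : Matrix ι ι ℝ} (hA : ∀ i j, 0 ≤ A i j) {x y : ι → ℝ}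
    (h : ∀ i, x i ≤ y i) (i : ι) : (A *ᵥ x) i ≤ (A *ᵥ y) i :=
  Finset.sum_le_sum fun j _ => mul_le_mul_of_nonneg_left (h j) (hA i j)

theorem mulVec_nonneg {A : Matrix ι ι ℝ} (hA : ∀ i j, 0 ≤ A i j) {x : ι → ℝ}
    (h : ∀ i, 0 ≤ x i) (i : ι) : 0 ≤ (A *ᵥ x) i :=
  Finset.sum_nonneg fun j _ => mul_nonneg (hA i j) (h j)

theorem entry_mul_le_mulVec {A : Matrix ι ι ℝ} (hA : ∀ i j, 0 ≤ A i j) {x : ι → ℝ}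
    (h : ∀ i, 0 ≤ x i) (i j : ι) : A i j * x j ≤ (A *ᵥ x) i :=
  Finset.single_le_sum (f := fun j => A i j * x j) (fun j _ => mul_nonneg (hA i j) (h j))
    (Finset.mem_univ j)

theorem mul_entry_nonneg {A B : Matrix ι ι ℝ} (hA : ∀ i j, 0 ≤ A i j) (hB : ∀ i j, 0 ≤ B i j)
    (i j : ι) : 0 ≤ (A * B) i j :=
  Finset.sum_nonneg fun k _ => mul_nonneg (hA i k) (hB k j)

theorem mul_entry_pos {A B : Matrix ι ι ℝ} (hA : ∀ i j, 0 ≤ A i j) (hB : ∀ i j, 0 ≤ B i j)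
    {i j k : ι} (h : 0 < A i j) (h' : 0 < B j k) : 0 < (A * B) i k :=
  (mul_pos h h').trans_le (Finset.single_le_sum (f := fun j => A i j * B j k)
    (fun j _ => mul_nonneg (hA i j) (hB j k)) (Finset.mem_univ j))

/-- For stability, a perturbation `v` of the input becomes `C • A v` after `F`: either coordinate
`j` is unchanged, or `A v` is a definite fraction of `A x` there and bounds both outputs. -/
theorem RoundedSystem.comp {Φ : Set ℝ} (hΦ : IsScaleSet Φ) {A B : Matrix ι ι ℝ}
    {F G : (ι → ℝ) → ι → ℝ} (hF : RoundedSystem Φ A F) (hG : RoundedSystem Φ B G) :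
    RoundedSystem Φ (B * A) (G ∘ F) where
  mem x hx := hG.mem _ (hF.mem x hx)
  coeff_nonneg := mul_entry_nonneg hG.coeff_nonneg hF.coeff_nonneg
  homog α x := by simp [hF.homog, hG.homog]
  bound := by
    obtain ⟨c, hc, h⟩ := hF.bound
    obtain ⟨c', hc', h'⟩ := hG.bound
    refine ⟨c' * c, mul_pos hc' hc, fun x hx i => ?_⟩
    have hFx := hF.mem x hx
    obtain ⟨h1, h2⟩ := h' (F x) hFx i
    have h3 : (B *ᵥ (A *ᵥ x)) i ≤ (B *ᵥ (c • F x)) i :=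
      mulVec_le_mulVec hG.coeff_nonneg (fun j => (h x hx j).1) i
    have h4 : (B *ᵥ F x) i ≤ (B *ᵥ (c • (A *ᵥ x))) i :=
      mulVec_le_mulVec hG.coeff_nonneg (fun j => (h x hx j).2) i
    rw [mulVec_smul, Pi.smul_apply, smul_eq_mul] at h3 h4
    rw [← mulVec_mulVec, Function.comp_apply]
    constructor
    · calc _ ≤ c * (c' * G (F x) i) := h3.trans (mul_le_mul_of_nonneg_left h1 hc.le)
        _ = _ := by ring
    · calc _ ≤ c' * (c * (B *ᵥ (A *ᵥ x)) i) := h2.trans (mul_le_mul_of_nonneg_left h4 hc'.le)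
        _ = _ := by ring
  stable := by
    obtain ⟨c, hc, hb⟩ := hF.bound
    obtain ⟨ε, hε, h⟩ := hF.stable
    obtain ⟨ε', hε', h'⟩ := hG.stable
    -- `1 / ε` bounds `A x` by `A v` where stability of `F` fails; the `1` accounts for `x' ≤ x +
    -- v`.
    set C := c * (1 / ε + 1) with hC
    have hC0 : 0 < C := by positivity
    refine ⟨ε' / (C * c), by positivity, fun x x' v hx hx' hv hvx i hi => ?_⟩
    have hAv := mulVec_nonneg hF.coeff_nonneg hv
    have hstep : ∀ j, F x j = F x' j ∨ (F x j ≤ (C • (A *ᵥ v)) j ∧ F x' j ≤ (C • (A *ᵥ v)) j) := by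
      intro j
      by_cases hj : (A *ᵥ v) j ≤ ε * (A *ᵥ x) j
      · exact Or.inl (h x x' v hx hx' hv hvx j hj)
      · right
        have h1 : (A *ᵥ x) j ≤ 1 / ε * (A *ᵥ v) j := by
          rw [one_div, ← div_eq_inv_mul, le_div_iff₀ hε, mul_comm]
          exact (not_le.1 hj).le
        have h2 : (A *ᵥ x') j ≤ (A *ᵥ x) j + (A *ᵥ v) j := by
          rw [← Pi.add_apply, ← mulVec_add]
          refine mulVec_le_mulVec hF.coeff_nonneg (fun l => ?_) j
          have := hΦ.nonneg _ (hx l)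
          have := hv l
          rw [Pi.add_apply]
          rcases hvx l with e | ⟨_, e⟩ <;> linarith
        rw [Pi.smul_apply, smul_eq_mul, hC, mul_assoc]
        have h3 := hAv j
        exact ⟨(hb x hx j).2.trans (mul_le_mul_of_nonneg_left (by linarith) hc.le),
          (hb x' hx' j).2.trans (mul_le_mul_of_nonneg_left (by linarith) hc.le)⟩
    refine h' (F x) (F x') (C • (A *ᵥ v)) (hF.mem x hx) (hF.mem x' hx')
      (fun j => mul_nonneg hC0.le (hAv j)) hstep i ?_
    have h3 : (B *ᵥ (A *ᵥ x)) i ≤ (B *ᵥ (c • F x)) i :=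
      mulVec_le_mulVec hG.coeff_nonneg (fun j => (hb x hx j).1) i
    rw [mulVec_smul, Pi.smul_apply, smul_eq_mul] at h3 ⊢
    rw [← mulVec_mulVec, ← mulVec_mulVec] at hi
    calc C * (B *ᵥ (A *ᵥ v)) i ≤ C * (ε' / (C * c) * (c * (B *ᵥ F x) i)) :=
          mul_le_mul_of_nonneg_left
            (hi.trans (mul_le_mul_of_nonneg_left h3 (by positivity))) hC0.le
      _ = ε' * (B *ᵥ F x) i := by field_simp

/-- If `i₁` is an input of `i`, inputs that are small relative to that of `i₁` are irrelevant. -/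
theorem RoundedSystem.eq_of_inputs {Φ : Set ℝ} (hΦ : IsScaleSet Φ) {A : Matrix ι ι ℝ}
    {G : (ι → ℝ) → ι → ℝ} (hG : RoundedSystem Φ A G) {i i₁ : ι} (hi : 0 < A i i₁) :
    ∃ ε : ℝ, 0 < ε ∧ ∀ x x' : ι → ℝ, (∀ i, x i ∈ Φ) → (∀ i, x' i ∈ Φ) →
      (∀ j, 0 < A i j → x j = x' j ∨ (x j ≤ ε * x i₁ ∧ x' j ≤ ε * x i₁)) → G x i = G x' i := by
  classical
  obtain ⟨ε, hε, h⟩ := hG.stable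
  set R := ∑ j, A i j with hR
  have hR0 : 0 < R := hi.trans_le
    (Finset.single_le_sum (f := fun j => A i j) (fun j _ => hG.coeff_nonneg i j)
      (Finset.mem_univ i₁))
  -- A perturbation of this size, relative to `x i₁`, on all inputs contributes `ε * A i i₁ * x i₁`
  -- in total. Non-inputs may be perturbed arbitrarily, their coefficient being zero.
  refine ⟨ε * A i i₁ / R, by positivity, fun x x' hx hx' hxx => ?_⟩
  have hx0 := fun j => hΦ.nonneg _ (hx j)
  have hx0' := fun j => hΦ.nonneg _ (hx' j)
  have hδ : 0 ≤ ε * A i i₁ / R * x i₁ := mul_nonneg (by positivity) (hx0 i₁)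
  refine h x x' (fun j => if 0 < A i j then ε * A i i₁ / R * x i₁ else x j + x' j) hx hx'
    (fun j => ?_) (fun j => ?_) i ?_
  · split_ifs
    · exact hδ
    · exact add_nonneg (hx0 j) (hx0' j)
  · split_ifs with hj
    · exact hxx j hj
    · right
      constructor <;> linarith [hx0 j, hx0' j]
  · calc _ ≤ ∑ j, A i j * (ε * A i i₁ / R * x i₁) := by
          refine Finset.sum_le_sum fun j _ => ?_
          dsimp only
          split_ifs with hj
          · exact le_rfl
          · rw [le_antisymm (not_lt.1 hj) (hG.coeff_nonneg i j), zero_mul, zero_mul]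
      _ = ε * (A i i₁ * x i₁) := by
          rw [← Finset.sum_mul, ← hR]
          field_simp
      _ ≤ _ := mul_le_mul_of_nonneg_left (entry_mul_le_mulVec hG.coeff_nonneg hx0 i i₁) hε.le

variable [DecidableEq ι]

theorem pow_entry_nonneg {A : Matrix ι ι ℝ} (hA : ∀ i j, 0 ≤ A i j) (k : ℕ) (i j : ι) :
    0 ≤ (A ^ k) i j := by
  induction k generalizing i j with
  | zero => rw [pow_zero, Matrix.one_apply]; split_ifs <;> norm_num
  | succ k ih => rw [pow_succ]; exact mul_entry_nonneg ih hA i j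

theorem pow_add_entry_pos {A : Matrix ι ι ℝ} (hA : ∀ i j, 0 ≤ A i j) {k l : ℕ} {i j m : ι}
    (h : 0 < (A ^ k) i j) (h' : 0 < (A ^ l) j m) : 0 < (A ^ (k + l)) i m := by
  rw [pow_add]
  exact mul_entry_pos (pow_entry_nonneg hA k) (pow_entry_nonneg hA l) h h'

theorem pow_mul_entry_pos {A : Matrix ι ι ℝ} (hA : ∀ i j, 0 ≤ A i j) {k : ℕ} {i : ι}
    (h : 0 < (A ^ k) i i) (n : ℕ) : 0 < (A ^ (k * n)) i i := by
  induction n with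
  | zero => simp
  | succ n ih => rw [mul_add, mul_one]; exact pow_add_entry_pos hA ih h

theorem roundedSystem_id {Φ : Set ℝ} (hΦ : IsScaleSet Φ) :
    RoundedSystem Φ (1 : Matrix ι ι ℝ) id where
  mem x hx i := hx i
  coeff_nonneg := pow_entry_nonneg (A := 0) (fun _ _ => le_rfl) 0
  homog _ _ := rfl
  bound := ⟨1, one_pos, fun x _ i => by simp⟩
  stable := by
    -- With `x i ≤ v i` and `v i ≤ x i / 2`, all values vanish.
    refine ⟨1 / 2, by norm_num, fun x x' v hx hx' hv h i hi => ?_⟩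
    rw [one_mulVec, one_mulVec] at hi
    have h1 := hΦ.nonneg _ (hx i)
    have h2 := hΦ.nonneg _ (hx' i)
    rcases h i with h | ⟨h3, h4⟩
    · exact h
    · simp only [id]
      linarith [hv i]

theorem RoundedSystem.iterate {Φ : Set ℝ} (hΦ : IsScaleSet Φ) {A : Matrix ι ι ℝ}
    {G : (ι → ℝ) → ι → ℝ} (hG : RoundedSystem Φ A G) (n : ℕ) : RoundedSystem Φ (A ^ n) G^[n] := by
  induction n with
  | zero => exact pow_zero A ▸ roundedSystem_id hΦ
  | succ n ih =>
    rw [pow_succ, Function.iterate_succ]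
    exact hG.comp hΦ ih

end System

/-! ### Regularity of coordinates, by pigeonhole and reachability -/

section Dynamics

open Filter Matrix

variable {ι : Type*}

/-- `f` is eventually scaled by a power of ten, and eventually zero or eventually positive. -/
def Regular (f : ℕ → ℝ) : Prop :=
  (∃ q, 0 < q ∧ ∃ a, ScaledBy q a f) ∧ ((∀ᶠ s in atTop, f s = 0) ∨ ∀ᶠ s in atTop, 0 < f s)

theorem Regular.of_eventually_eq_zero {f : ℕ → ℝ} (h : ∀ᶠ s in atTop, f s = 0) : Regular f := by
  refine ⟨⟨1, one_pos, 0, ?_⟩, Or.inl h⟩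
  filter_upwards [h, (tendsto_add_atTop_nat 1).eventually h] with s h1 h2
  simp [h1, h2]

theorem eventually_of_eventually_succ {P : ℕ → Prop} (h : ∀ᶠ s in atTop, P (s + 1)) :
    ∀ᶠ s in atTop, P s := by
  obtain ⟨N, h⟩ := eventually_atTop.1 h
  filter_upwards [eventually_ge_atTop (N + 1)] with s hs
  obtain ⟨t, rfl⟩ := Nat.exists_eq_add_of_le' (show 1 ≤ s by omega)
  exact h t (by omega)

theorem orbit_add {G : (ι → ℝ) → ι → ℝ} {z : ℕ → ι → ℝ} (hstep : ∀ s, z (s + 1) = G (z s)) (s n : ℕ) : z (s + n) = G^[n] (z s) := by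
  induction n with
  | zero => rfl
  | succ n ih => rw [← add_assoc, hstep, ih, Function.iterate_succ_apply']

theorem succ_pos_of_pos [Fintype ι] {Φ : Set ℝ} {A : Matrix ι ι ℝ} {G : (ι → ℝ) → ι → ℝ}
    {z : ℕ → ι → ℝ} (hΦ : IsScaleSet Φ) (hG : RoundedSystem Φ A G) (hstep : ∀ s, z (s + 1) = G (z s)) (hz : ∀ s i, z s i ∈ Φ)
    {i j : ι} (hij : 0 < A i j) {s : ℕ}
    (h : 0 < z s j) : 0 < z (s + 1) i := by
  obtain ⟨c, hc, hb⟩ := hG.bound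
  have h1 := (hb (z s) (hz s) i).1
  rw [← hstep] at h1
  have h2 := entry_mul_le_mulVec hG.coeff_nonneg (fun l => hΦ.nonneg _ (hz s l)) i j
  exact pos_of_mul_pos_right ((mul_pos hij h).trans_le (h2.trans h1)) hc.le

/-- A coordinate all of whose inputs are regular is regular. -/
theorem regular_of_inputs [Fintype ι] {Φ : Set ℝ} {A : Matrix ι ι ℝ}
    {G : (ι → ℝ) → ι → ℝ} {z : ℕ → ι → ℝ} (hΦ : IsScaleSet Φ) (hG : RoundedSystem Φ A G)
    (hstep : ∀ s, z (s + 1) = G (z s)) (hz : ∀ s i, z s i ∈ Φ) {i : ι}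
    (h : ∀ j, 0 < A i j → Regular fun s => z s j) : Regular fun s => z s i := by
  classical
  obtain ⟨q, hq, a, ha⟩ := exists_common_scale (U := {j | 0 < A i j}) fun j hj => (h j hj).1
  by_cases hex : ∃ j, 0 < A i j ∧ ∀ᶠ s in atTop, 0 < z s j
  · set V := Finset.univ.filter fun j => 0 < A i j ∧ ∀ᶠ s in atTop, 0 < z s j with hV
    have hmem : ∀ j, j ∈ V ↔ 0 < A i j ∧ ∀ᶠ s in atTop, 0 < z s j := fun j => by simp [hV]
    obtain ⟨j₁, hj₁, hmax⟩ := V.exists_max_image a (hex.imp fun j hj => (hmem j).2 hj)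
    obtain ⟨hj₁, hpos⟩ := (hmem j₁).1 hj₁
    obtain ⟨ε, hε, hins⟩ := hG.eq_of_inputs hΦ hj₁
    -- `j₁` has the largest rate among the eventually positive inputs. Inputs of the same rate match
    -- exactly after scaling; slower ones are negligible on both sides.
    have key : ∀ j, 0 < A i j → ∀ᶠ s in atTop, (10 : ℝ) ^ a j₁ * z s j = z (s + q) j ∨
        ((10 : ℝ) ^ a j₁ * z s j ≤ ε * ((10 : ℝ) ^ a j₁ * z s j₁) ∧
          z (s + q) j ≤ ε * ((10 : ℝ) ^ a j₁ * z s j₁)) := by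
      intro j hj
      rcases (h j hj).2 with h0 | h0
      · filter_upwards [h0, (tendsto_add_atTop_nat q).eventually h0] with s h1 h2
        left
        rw [h1, h2, mul_zero]
      · rcases (hmax j ((hmem j).2 ⟨hj, h0⟩)).eq_or_lt with e | hlt
        · filter_upwards [ha j hj] with s hs
          rw [← e, hs]
          exact Or.inl rfl
        · have hle := eventually_le_mul_of_rate_lt hq hlt (ha j hj) (ha j₁ hj₁)
            (fun s => hΦ.nonneg _ (hz s j)) hpos hε
          filter_upwards [hle, (tendsto_add_atTop_nat q).eventually hle, ha j₁ hj₁] with s h1 h2 h3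
          right
          rw [← h3]
          refine ⟨?_, h2⟩
          rw [h3, mul_left_comm]
          exact mul_le_mul_of_nonneg_left h1 (by positivity)
    refine ⟨⟨q, hq, a j₁, eventually_of_eventually_succ ?_⟩,
      Or.inr (eventually_of_eventually_succ ?_)⟩
    · have key' : ∀ᶠ s in atTop, ∀ j, 0 < A i j → _ :=
        eventually_all.2 fun j => eventually_imp_distrib_left.2 (key j)
      filter_upwards [key'] with s hs
      have := hins ((10 : ℝ) ^ a j₁ • z s) (z (s + q)) (fun l => hΦ.scale _ _ (hz s l))
        (hz _) hs
      rw [hG.homog, ← hstep, ← hstep, Pi.smul_apply, smul_eq_mul] at this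
      rw [this]
      congr 1
      ring
    · filter_upwards [hpos] with s hs
      exact succ_pos_of_pos hΦ hG hstep hz hj₁ hs
  · refine Regular.of_eventually_eq_zero (eventually_of_eventually_succ ?_)
    obtain ⟨c, hc, hb⟩ := hG.bound
    have hzero : ∀ᶠ s in atTop, ∀ j, 0 < A i j → z s j = 0 :=
      eventually_all.2 fun j => eventually_imp_distrib_left.2 fun hj =>
        (h j hj).2.resolve_right fun h0 => hex ⟨j, hj, h0⟩
    filter_upwards [hzero] with s hs
    have h1 := (hb (z s) (hz s) i).2
    have h2 : (A *ᵥ z s) i = 0 := by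
      refine Finset.sum_eq_zero fun j _ => ?_
      change A i j * z s j = 0
      rcases (hG.coeff_nonneg i j).eq_or_lt with e | hj
      · rw [← e, zero_mul]
      · rw [hs j hj, mul_zero]
    rw [h2, mul_zero, ← hstep] at h1
    exact le_antisymm h1 (hΦ.nonneg _ (hz _ i))

/-- Scaling by a power of ten brings `z s i₀` into `[1, 10]`; comparability then leaves finitely
many values for the coordinates in `T`. Pigeonhole is applied to these together with `s % q`, so
that the time difference is a multiple of `q`. -/
theorem exists_repeat [Finite ι] {Φ : Set ℝ} (hΦ : IsScaleSet Φ) {z : ℕ → ι → ℝ} (hz : ∀ s i, z s i ∈ Φ)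
    {T : Set ι} {i₀ : ι} {C : ι → ℝ} (hC : ∀ j, 0 < C j)
    (hfreq : ∃ᶠ s in atTop, 0 < z s i₀ ∧
      ∀ j ∈ T, z s i₀ ≤ C j * z s j ∧ z s j ≤ C j * z s i₀) (N : ℕ) {q : ℕ} (hq : 0 < q) :
    ∃ s, N ≤ s ∧ ∃ m, 0 < m ∧ ∃ a : ℤ, ∀ j ∈ T, z (s + q * m) j = (10 : ℝ) ^ a * z s j := by
  classical
  have hinf := Nat.frequently_atTop_iff_infinite.1 (hfreq.and_eventually (eventually_ge_atTop N))
  set α : ℕ → ℤ := fun s => -Int.log 10 (z s i₀) with hα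
  set X : ι → Set ℝ := fun j => if j ∈ T then Φ ∩ Set.Icc (1 / C j) (C j * 10) else {0} with hX
  have hfin : (Set.Iio q ×ˢ Set.pi Set.univ X).Finite := by
    refine (Set.finite_Iio q).prod (Set.Finite.pi fun j => ?_)
    simp only [hX]
    split_ifs
    · exact hΦ.finite _ _ (one_div_pos.2 (hC j))
    · exact Set.finite_singleton _
  have hmaps : Set.MapsTo
      (fun s => (s % q, fun j => if j ∈ T then (10 : ℝ) ^ α s * z s j else 0))
      {s | (0 < z s i₀ ∧ ∀ j ∈ T, z s i₀ ≤ C j * z s j ∧ z s j ≤ C j * z s i₀) ∧ N ≤ s}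
      (Set.Iio q ×ˢ Set.pi Set.univ X) := fun s hs => by
    obtain ⟨⟨hpos, hT⟩, -⟩ := hs
    refine ⟨Nat.mod_lt _ hq, fun j _ => ?_⟩
    simp only [hX]
    by_cases hj : j ∈ T
    · simp only [hj, if_true]
      have h1 : (10 : ℝ) ^ α s * z s i₀ ≥ 1 := by
        have h := Int.zpow_log_le_self (b := 10) (by norm_num) hpos
        simp only [hα]
        rw [_root_.zpow_neg, ge_iff_le, ← div_eq_inv_mul, one_le_div (by positivity)]
        exact_mod_cast h
      have h2 : (10 : ℝ) ^ α s * z s i₀ ≤ 10 := by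
        have h := Int.lt_zpow_succ_log_self (b := 10) (by norm_num) (z s i₀)
        rw [zpow_add₀ (by norm_num)] at h
        simp only [hα]
        rw [_root_.zpow_neg, ← div_eq_inv_mul, div_le_iff₀ (by positivity), mul_comm]
        have := h.le
        norm_num at this ⊢
        exact this
      obtain ⟨h3, h4⟩ := hT j hj
      have h5 : (0 : ℝ) < 10 ^ α s := by positivity
      refine ⟨hΦ.scale _ _ (hz s j), ?_, ?_⟩
      · rw [div_le_iff₀ (hC j)]
        calc (1 : ℝ) ≤ 10 ^ α s * z s i₀ := h1
          _ ≤ 10 ^ α s * (C j * z s j) := mul_le_mul_of_nonneg_left h3 h5.le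
          _ = _ := by ring
      · calc (10 : ℝ) ^ α s * z s j ≤ 10 ^ α s * (C j * z s i₀) :=
              mul_le_mul_of_nonneg_left h4 h5.le
          _ = C j * (10 ^ α s * z s i₀) := by ring
          _ ≤ C j * 10 := mul_le_mul_of_nonneg_left h2 (hC j).le
    · simp [hj]
  obtain ⟨s, ⟨_, hsN⟩, t, _, hst, heq⟩ := hinf.exists_lt_map_eq_of_mapsTo hmaps hfin
  rw [Prod.mk.injEq] at heq
  obtain ⟨hmod, hval⟩ := heq
  obtain ⟨m, hm⟩ := (Nat.modEq_iff_dvd' hst.le).1 hmod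
  refine ⟨s, hsN, m, ?_, α s - α t, fun j hj => ?_⟩
  · rcases Nat.eq_zero_or_pos m with rfl | h
    · omega
    · exact h
  · rw [← hm, Nat.add_sub_cancel' hst.le]
    have := congrFun hval j
    simp only [hj, if_true] at this
    rw [zpow_sub₀ (by norm_num), div_mul_eq_mul_div, this, mul_div_cancel_left₀ _ (by positivity)]

variable [Fintype ι] [DecidableEq ι]

/-- The value at `j` influences the value at `i` after some number of steps. -/
def Reach (A : Matrix ι ι ℝ) (i j : ι) : Prop := ∃ k, 0 < (A ^ k) i j

theorem Reach.trans {A : Matrix ι ι ℝ} (hA : ∀ i j, 0 ≤ A i j) {i j l : ι} (h : Reach A i j)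
    (h' : Reach A j l) : Reach A i l := by
  obtain ⟨k, h⟩ := h
  obtain ⟨k', h'⟩ := h'
  exact ⟨k + k', pow_add_entry_pos hA h h'⟩

theorem Reach.refl (A : Matrix ι ι ℝ) (i : ι) : Reach A i i := ⟨0, by simp⟩

theorem Reach.of_pos {A : Matrix ι ι ℝ} {i j : ι} (h : 0 < A i j) : Reach A i j := ⟨1, by simpa⟩

/-- The loop at `i` pads walks of different lengths to a common one. -/
theorem exists_uniform_reach {A : Matrix ι ι ℝ} (hA : ∀ i j, 0 ≤ A i j) {i : ι} (hi : 0 < A i i) :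
    ∃ K, ∀ l, Reach A i l → 0 < (A ^ K) i l := by
  have h : ∀ l, ∃ k, Reach A i l → 0 < (A ^ k) i l := fun l => by
    by_cases hl : Reach A i l
    · exact hl.imp fun k hk _ => hk
    · exact ⟨0, fun h => absurd h hl⟩
  choose k hk using h
  refine ⟨∑ l, k l, fun l hl => ?_⟩
  obtain ⟨n, hn⟩ := Nat.exists_eq_add_of_le' (Finset.single_le_sum (f := k)
    (fun _ _ => Nat.zero_le _) (Finset.mem_univ l))
  rw [hn]
  refine pow_add_entry_pos hA (j := i) ?_ (hk l hl)
  rw [← one_mul n]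
  exact pow_mul_entry_pos hA (by simpa using hi) n

/-! ### Regularity along an orbit -/

section Orbit

variable {Φ : Set ℝ} {A : Matrix ι ι ℝ} {G : (ι → ℝ) → ι → ℝ} {z : ℕ → ι → ℝ}

/-- Look `K` steps back, with `K` uniform for `i`: every `l` feeding `j` in `K` steps is reachable
from `i`, hence feeds `i` in exactly `K` steps too. -/
theorem eventually_le_of_reach (hΦ : IsScaleSet Φ) (hG : RoundedSystem Φ A G)
    (hstep : ∀ s, z (s + 1) = G (z s)) (hz : ∀ s i, z s i ∈ Φ) {i j : ι} (hi : 0 < A i i)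
    (hij : Reach A i j) : ∃ C : ℝ, 0 < C ∧ ∀ᶠ s in atTop, z s j ≤ C * z s i := by
  obtain ⟨K, hK⟩ := exists_uniform_reach hG.coeff_nonneg hi
  have hA := pow_entry_nonneg hG.coeff_nonneg K
  obtain ⟨c, hc, hb⟩ := (hG.iterate hΦ K).bound
  have hsum : 0 ≤ ∑ l, (A ^ K) j l * (c / (A ^ K) i l) :=
    Finset.sum_nonneg fun l _ => mul_nonneg (hA j l) (div_nonneg hc.le (hA i l))
  refine ⟨c * (∑ l, (A ^ K) j l * (c / (A ^ K) i l)) + 1, by positivity, ?_⟩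
  filter_upwards [eventually_ge_atTop K] with t ht
  obtain ⟨s, rfl⟩ := Nat.exists_eq_add_of_le' ht
  have hz0 : ∀ l, 0 ≤ z s l := fun l => hΦ.nonneg _ (hz s l)
  have hpos : 0 ≤ z (s + K) i := hΦ.nonneg _ (hz _ i)
  have e := orbit_add hstep s K
  obtain ⟨h1, -⟩ := hb (z s) (hz s) i
  obtain ⟨-, h2⟩ := hb (z s) (hz s) j
  rw [← e] at h1 h2
  have h3 : ((A ^ K) *ᵥ z s) j ≤ (∑ l, (A ^ K) j l * (c / (A ^ K) i l)) * z (s + K) i := by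
    rw [Finset.sum_mul]
    refine Finset.sum_le_sum fun l _ => ?_
    change (A ^ K) j l * z s l ≤ _
    rw [mul_assoc]
    rcases (hA j l).eq_or_lt with h | h
    · rw [← h, zero_mul, zero_mul]
    · refine mul_le_mul_of_nonneg_left ?_ h.le
      have hil := hK l (hij.trans hG.coeff_nonneg ⟨K, h⟩)
      rw [div_mul_eq_mul_div, le_div_iff₀ hil, mul_comm]
      exact (entry_mul_le_mulVec hA hz0 i l).trans h1
  calc z (s + K) j ≤ c * ((A ^ K) *ᵥ z s) j := h2
    _ ≤ c * ((∑ l, (A ^ K) j l * (c / (A ^ K) i l)) * z (s + K) i) :=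
      mul_le_mul_of_nonneg_left h3 hc.le
    _ ≤ _ := by rw [add_mul, mul_assoc]; linarith

/-- If the coordinates outside the class of `i₀` and outside `J` are negligible, a repetition up to
a power of ten on the class persists as long as it does on `J`. -/
theorem repetition_persists (hΦ : IsScaleSet Φ) (hG : RoundedSystem Φ A G)
    (hstep : ∀ s, z (s + 1) = G (z s)) (hz : ∀ s i, z s i ∈ Φ) {i₀ : ι}
    (hloop : ∀ i, Reach A i₀ i → Reach A i i₀ → 0 < A i i) {J : Set ι}
    (hrest : ∀ j, Reach A i₀ j → ¬ Reach A j i₀ → j ∉ J → ∀ ε : ℝ, 0 < ε →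
      ∀ᶠ s in atTop, z s j ≤ ε * z s i₀) :
    ∃ N, ∀ s₁ s₂ : ℕ, N ≤ s₁ → s₁ ≤ s₂ → ∀ a : ℤ,
      (∀ i, Reach A i₀ i → Reach A i i₀ → z s₂ i = (10 : ℝ) ^ a * z s₁ i) →
      (∀ j ∈ J, ∀ n, z (s₂ + n) j = (10 : ℝ) ^ a * z (s₁ + n) j) →
      ∀ n i, Reach A i₀ i → Reach A i i₀ → z (s₂ + n) i = (10 : ℝ) ^ a * z (s₁ + n) i := by
  have hA := hG.coeff_nonneg
  have hε : ∀ i, ∃ ε : ℝ, 0 < ε ∧ (Reach A i₀ i → Reach A i i₀ → ∀ x x' : ι → ℝ,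
      (∀ i, x i ∈ Φ) → (∀ i, x' i ∈ Φ) →
      (∀ j, 0 < A i j → x j = x' j ∨ (x j ≤ ε * x i ∧ x' j ≤ ε * x i)) → G x i = G x' i) := by
    intro i
    by_cases hi : Reach A i₀ i ∧ Reach A i i₀
    · obtain ⟨ε, h1, h2⟩ := hG.eq_of_inputs hΦ (hloop i hi.1 hi.2)
      exact ⟨ε, h1, fun _ _ => h2⟩
    · exact ⟨1, one_pos, fun h1 h2 => absurd ⟨h1, h2⟩ hi⟩
  choose ε hε0 hε using hε
  -- Negligible against `i₀` means negligible against every `i` in the class, since `z s i₀ ≤ C * z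
  -- s i`. The loop makes `i` its own reference input.
  have hneg : ∀ᶠ s in atTop, ∀ i, Reach A i₀ i → Reach A i i₀ → ∀ j, Reach A i₀ j →
      ¬ Reach A j i₀ → j ∉ J → z s j ≤ ε i * z s i := by
    refine eventually_all.2 fun i => ?_
    by_cases hi : Reach A i₀ i ∧ Reach A i i₀
    · obtain ⟨C, hC, hdom⟩ := eventually_le_of_reach hΦ hG hstep hz (hloop i hi.1 hi.2) hi.2
      have : ∀ᶠ s in atTop, ∀ j, (Reach A i₀ j ∧ ¬ Reach A j i₀ ∧ j ∉ J) →
          z s j ≤ ε i / C * z s i₀ :=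
        eventually_all.2 fun j => eventually_imp_distrib_left.2 fun hj =>
          hrest j hj.1 hj.2.1 hj.2.2 _ (div_pos (hε0 i) hC)
      filter_upwards [this, hdom] with s h1 h2 _ _ j hj1 hj2 hj3
      calc z s j ≤ ε i / C * z s i₀ := h1 j ⟨hj1, hj2, hj3⟩
        _ ≤ ε i / C * (C * z s i) := mul_le_mul_of_nonneg_left h2 (div_pos (hε0 i) hC).le
        _ = _ := by field_simp
    · exact Eventually.of_forall fun s h1 h2 => absurd ⟨h1, h2⟩ hi
  obtain ⟨N, hN⟩ := eventually_atTop.1 hneg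
  refine ⟨N, fun s₁ s₂ hs₁ hs₂ a hS hJ n => ?_⟩
  induction n with
  | zero => exact hS
  | succ n ih =>
    intro i hi hi'
    have := hε i hi hi' ((10 : ℝ) ^ a • z (s₁ + n)) (z (s₂ + n))
      (fun l => hΦ.scale _ _ (hz _ l)) (hz _) (fun j hj => ?_)
    · rw [hG.homog, ← hstep, ← hstep, Pi.smul_apply, smul_eq_mul] at this
      rw [← add_assoc, ← add_assoc, this]
    · simp only [Pi.smul_apply, smul_eq_mul]
      have hj0 : Reach A i₀ j := hi.trans hA (Reach.of_pos hj)
      by_cases hj1 : Reach A j i₀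
      · exact Or.inl (ih j hj0 hj1).symm
      · by_cases hj2 : j ∈ J
        · exact Or.inl (hJ j hj2 n).symm
        · right
          constructor
          · rw [mul_left_comm]
            exact mul_le_mul_of_nonneg_left (hN _ (by omega) i hi hi' j hj0 hj1 hj2)
              (by positivity)
          · rw [← ih i hi hi']
            exact hN _ (by omega) i hi hi' j hj0 hj1 hj2

/-- A coordinate with a loop is regular if the coordinates strictly above it are. -/
theorem regular_of_loop (hΦ : IsScaleSet Φ) (hG : RoundedSystem Φ A G)
    (hstep : ∀ s, z (s + 1) = G (z s)) (hz : ∀ s i, z s i ∈ Φ) {i₀ : ι} (hi₀ : 0 < A i₀ i₀)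
    (hloop : ∀ i, Reach A i₀ i → Reach A i i₀ → 0 < A i i)
    (h : ∀ j, Reach A i₀ j → ¬ Reach A j i₀ → Regular fun s => z s j) :
    Regular fun s => z s i₀ := by
  classical
  have hz0 : ∀ s i, 0 ≤ z s i := fun s i => hΦ.nonneg _ (hz s i)
  by_cases hex : ∃ s, 0 < z s i₀
  swap
  · refine Regular.of_eventually_eq_zero (Eventually.of_forall fun s => ?_)
    exact le_antisymm (not_lt.1 fun hs => hex ⟨s, hs⟩) (hz0 s i₀)
  have hpos : ∀ᶠ s in atTop, 0 < z s i₀ := by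
    obtain ⟨s, hs⟩ := hex
    refine eventually_atTop.2 ⟨s, fun t ht => ?_⟩
    induction t, ht using Nat.le_induction with
    | base => exact hs
    | succ t _ ih => exact succ_pos_of_pos hΦ hG hstep hz hi₀ ih
  refine ⟨?_, Or.inr hpos⟩
  have hcomp : ∀ j, ∃ C : ℝ, 0 < C ∧ (Reach A i₀ j → Reach A j i₀ →
      ∀ᶠ s in atTop, z s i₀ ≤ C * z s j ∧ z s j ≤ C * z s i₀) := by
    intro j
    by_cases hj : Reach A i₀ j ∧ Reach A j i₀
    · obtain ⟨C, hC, h1⟩ := eventually_le_of_reach hΦ hG hstep hz hi₀ hj.1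
      obtain ⟨C', hC', h2⟩ := eventually_le_of_reach hΦ hG hstep hz (hloop j hj.1 hj.2) hj.2
      refine ⟨C + C', by positivity, fun _ _ => ?_⟩
      filter_upwards [h1, h2] with s h1 h2
      rw [add_mul, add_mul]
      have := mul_nonneg hC.le (hz0 s j)
      have := mul_nonneg hC'.le (hz0 s i₀)
      constructor <;> linarith
    · exact ⟨1, one_pos, fun h1 h2 => absurd ⟨h1, h2⟩ hj⟩
  choose C hC hcomp using hcomp
  have hcomp' : ∀ᶠ s in atTop, ∀ j, (Reach A i₀ j ∧ Reach A j i₀) →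
      z s i₀ ≤ C j * z s j ∧ z s j ≤ C j * z s i₀ :=
    eventually_all.2 fun j => eventually_imp_distrib_left.2 fun hj => hcomp j hj.1 hj.2
  by_cases hneg : ∀ j, Reach A i₀ j → ¬ Reach A j i₀ → ∀ ε : ℝ, 0 < ε →
      ∀ᶠ s in atTop, z s j ≤ ε * z s i₀
  · obtain ⟨N, hN⟩ := repetition_persists hΦ hG hstep hz hloop (J := ∅)
      fun j h1 h2 _ => hneg j h1 h2
    obtain ⟨s, hs, m, hm, a, ha⟩ := exists_repeat hΦ hz
      (T := {j | Reach A i₀ j ∧ Reach A j i₀}) hC (hpos.and hcomp').frequently N one_pos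
    rw [one_mul] at ha
    have := hN s (s + m) hs (by omega) a (fun i h1 h2 => ha i ⟨h1, h2⟩) (by simp)
    refine ⟨m, hm, a, eventually_atTop.2 ⟨s, fun t ht => ?_⟩⟩
    obtain ⟨n, rfl⟩ := Nat.exists_eq_add_of_le ht
    rw [add_right_comm]
    exact this n i₀ (Reach.refl A i₀) (Reach.refl A i₀)
  · push Not at hneg
    obtain ⟨j₀, hj₀, hj₀', ε, hε, hfreq⟩ := hneg
    obtain ⟨q, hq, b, hb⟩ := exists_common_scale (U := {j | Reach A i₀ j ∧ ¬ Reach A j i₀})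
      fun j hj => (h j hj.1 hj.2).1
    have hj₀pos : ∀ᶠ s in atTop, 0 < z s j₀ := by
      refine (h j₀ hj₀ hj₀').2.resolve_left fun h0 => ?_
      obtain ⟨s, h1, h2⟩ := (hfreq.and_eventually h0).exists
      have := mul_nonneg hε.le (hz0 s i₀)
      dsimp only at h2
      linarith
    obtain ⟨C₀, hC₀, hdom⟩ := eventually_le_of_reach hΦ hG hstep hz hi₀ hj₀
    -- A faster upstream coordinate would still be at most `C₁ * z s i₀`, making `j₀` negligible
    -- against `i₀`, contrary to its choice.
    have hle : ∀ j, Reach A i₀ j → ¬ Reach A j i₀ → (∀ᶠ s in atTop, 0 < z s j) → b j ≤ b j₀ := by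
      intro j hj hj' hjpos
      by_contra! hlt
      obtain ⟨C₁, hC₁, hdom₁⟩ := eventually_le_of_reach hΦ hG hstep hz hi₀ hj
      have hsmall := eventually_le_mul_of_rate_lt hq hlt (hb j₀ ⟨hj₀, hj₀'⟩) (hb j ⟨hj, hj'⟩)
        (fun s => hz0 s j₀) hjpos (div_pos hε hC₁)
      obtain ⟨s, h1, h2, h3⟩ := (hfreq.and_eventually (hsmall.and hdom₁)).exists
      have : ε / C₁ * z s j ≤ ε / C₁ * (C₁ * z s i₀) :=
        mul_le_mul_of_nonneg_left h3 (div_pos hε hC₁).le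
      have e : ε / C₁ * (C₁ * z s i₀) = ε * z s i₀ := by field_simp
      linarith
    obtain ⟨N, hN⟩ := repetition_persists hΦ hG hstep hz hloop
      (J := {j | (Reach A i₀ j ∧ ¬ Reach A j i₀) ∧ b j = b j₀}) (by
        intro j hj hj' hjJ δ hδ
        rcases (h j hj hj').2 with h0 | h0
        · filter_upwards [h0] with s hs
          rw [hs]
          exact mul_nonneg hδ.le (hz0 s i₀)
        · have hlt : b j < b j₀ := lt_of_le_of_ne (hle j hj hj' h0) fun e => hjJ ⟨⟨hj, hj'⟩, e⟩
          have hsmall := eventually_le_mul_of_rate_lt hq hlt (hb j ⟨hj, hj'⟩)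
            (hb j₀ ⟨hj₀, hj₀'⟩) (fun s => hz0 s j) hj₀pos (div_pos hδ hC₀)
          filter_upwards [hsmall, hdom] with s h1 h2
          calc z s j ≤ δ / C₀ * z s j₀ := h1
            _ ≤ δ / C₀ * (C₀ * z s i₀) := mul_le_mul_of_nonneg_left h2 (div_pos hδ hC₀).le
            _ = _ := by field_simp)
    have hb' : ∀ᶠ s in atTop, ∀ j, (Reach A i₀ j ∧ ¬ Reach A j i₀) →
        z (s + q) j = (10 : ℝ) ^ b j * z s j :=
      eventually_all.2 fun j => eventually_imp_distrib_left.2 fun hj => hb j hj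
    obtain ⟨N', hN'⟩ := eventually_atTop.1 (hb'.and hj₀pos)
    have hfreq' : ∃ᶠ s in atTop, 0 < z s i₀ ∧
        ∀ j ∈ insert j₀ {j | Reach A i₀ j ∧ Reach A j i₀},
          z s i₀ ≤ (C j + (C₀ + 1 / ε)) * z s j ∧ z s j ≤ (C j + (C₀ + 1 / ε)) * z s i₀ := by
      refine (hfreq.and_eventually (hpos.and (hcomp'.and hdom))).mono ?_
      rintro s ⟨h1, h2, h3, h4⟩
      refine ⟨h2, fun j hj => ?_⟩
      have e1 := mul_nonneg hC₀.le (hz0 s j)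
      have e2 := mul_nonneg hC₀.le (hz0 s i₀)
      have e3 := mul_nonneg (one_div_pos.2 hε).le (hz0 s j)
      have e4 := mul_nonneg (one_div_pos.2 hε).le (hz0 s i₀)
      have e5 := mul_nonneg (hC j).le (hz0 s j)
      have e6 := mul_nonneg (hC j).le (hz0 s i₀)
      simp only [add_mul]
      rcases hj with rfl | hj
      · have e7 : z s i₀ ≤ 1 / ε * z s j := by
          rw [one_div, ← div_eq_inv_mul, le_div_iff₀ hε, mul_comm]
          exact h1.le
        constructor <;> linarith
      · obtain ⟨h5, h6⟩ := h3 j hj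
        constructor <;> linarith
    obtain ⟨s, hs, m, hm, a, ha⟩ := exists_repeat hΦ hz
      (fun j => by have := hC j; positivity) hfreq' (max N N') hq
    have hsN : N ≤ s := (le_max_left _ _).trans hs
    have hsN' : N' ≤ s := (le_max_right _ _).trans hs
    have hiter : ∀ j, (Reach A i₀ j ∧ ¬ Reach A j i₀) → ∀ n,
        z (s + q * m + n) j = ((10 : ℝ) ^ b j) ^ m * z (s + n) j := by
      intro j hj n
      rw [add_right_comm]
      exact mul_zpow_of_step (f := fun s => z s j) (fun t ht => (hN' t ht).1 j hj) m (by omega)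
    -- Including `j₀` in the repetition ties the factor of the class to the rate of `j₀`, so all of
    -- `J` repeats with the same factor.
    have hrate : ((10 : ℝ) ^ b j₀) ^ m = (10 : ℝ) ^ a := by
      have h1 := ha j₀ (Set.mem_insert _ _)
      have h2 := hiter j₀ ⟨hj₀, hj₀'⟩ 0
      rw [add_zero, add_zero, h1] at h2
      exact (mul_right_cancel₀ (hN' s hsN').2.ne' h2).symm
    have := hN s (s + q * m) hsN (by omega) a
      (fun i h1 h2 => ha i (Set.mem_insert_of_mem _ ⟨h1, h2⟩))
      (fun j hj n => by rw [hiter j hj.1, hj.2, hrate])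
    refine ⟨q * m, Nat.mul_pos hq hm, a, eventually_atTop.2 ⟨s, fun t ht => ?_⟩⟩
    obtain ⟨n, rfl⟩ := Nat.exists_eq_add_of_le ht
    rw [add_right_comm]
    exact this n i₀ (Reach.refl A i₀) (Reach.refl A i₀)

/-- Induction on strict reachability. By `hap`, a loop at `i` spreads to its whole class, while
without a loop `i` lies on no cycle and all its inputs are strictly upstream. -/
theorem regular_of_aperiodic (hΦ : IsScaleSet Φ) (hG : RoundedSystem Φ A G)
    (hstep : ∀ s, z (s + 1) = G (z s)) (hz : ∀ s i, z s i ∈ Φ)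
    (hap : ∀ i k, 0 < k → 0 < (A ^ k) i i → 0 < A i i) (i : ι) : Regular fun s => z s i := by
  have hA := hG.coeff_nonneg
  let R : ι → ι → Prop := fun j i => Reach A i j ∧ ¬ Reach A j i
  have : IsTrans ι R := ⟨fun i j l h h' => ⟨h'.1.trans hA h.1, fun hn => h'.2 (h.1.trans hA hn)⟩⟩
  have : Std.Irrefl R := ⟨fun i h => h.2 h.1⟩
  induction i using (Finite.wellFounded_of_trans_of_irrefl R).induction with
  | _ i ih =>
  by_cases hi : 0 < A i i
  · refine regular_of_loop hΦ hG hstep hz hi (fun j h1 h2 => ?_) fun j h1 h2 => ih j ⟨h1, h2⟩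
    obtain ⟨k, h1⟩ := h1
    obtain ⟨l, h2⟩ := h2
    exact hap j (l + 1 + k) (by omega)
      (pow_add_entry_pos hA (pow_add_entry_pos hA h2 (by simpa using hi)) h1)
  · refine regular_of_inputs hΦ hG hstep hz fun j hj => ih j ⟨Reach.of_pos hj, fun h => hi ?_⟩
    obtain ⟨k, hk⟩ := h
    exact hap i (1 + k) (by omega) (pow_add_entry_pos hA (by simpa using hj) hk)

/-- `D` is a common multiple of the lengths of one closed walk through each coordinate that has one.
-/
theorem exists_aperiodic_pow (hA : ∀ i j, 0 ≤ A i j) : ∃ D, 0 < D ∧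
    ∀ i k, 0 < k → 0 < ((A ^ D) ^ k) i i → 0 < (A ^ D) i i := by
  have h : ∀ i, ∃ l, 0 < l ∧ ∀ k, 0 < k → 0 < (A ^ k) i i → 0 < (A ^ l) i i := by
    intro i
    by_cases hi : ∃ k, 0 < k ∧ 0 < (A ^ k) i i
    · obtain ⟨k, hk, h⟩ := hi
      exact ⟨k, hk, fun _ _ _ => h⟩
    · exact ⟨1, one_pos, fun k hk h => absurd ⟨k, hk, h⟩ hi⟩
  choose l hl h using h
  have hD : 0 < ∏ i, l i := Finset.prod_pos fun i _ => hl i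
  refine ⟨∏ i, l i, hD, fun i k hk hpos => ?_⟩
  rw [← pow_mul] at hpos
  obtain ⟨m, hm⟩ := Finset.dvd_prod_of_mem l (Finset.mem_univ i)
  rw [hm]
  exact pow_mul_entry_pos hA (h i _ (Nat.mul_pos hD hk) hpos) m

theorem isEventuallyPeriodic_hittingTimes_of_roundedSystem {d : ℕ}
    {A : Matrix (Fin d) (Fin d) ℝ} {G : (Fin d → ℝ) → Fin d → ℝ} {z : ℕ → Fin d → ℝ}
    (hΦ : IsScaleSet Φ) (hG : RoundedSystem Φ A G) (hstep : ∀ s, z (s + 1) = G (z s))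
    (hz : ∀ s i, z s i ∈ Φ) {Y : Set (Fin d → ℝ)} (hY : IsSemialgebraic Y) :
    IsEventuallyPeriodic (hittingTimes z Y) := by
  obtain ⟨D, hD, hap⟩ := exists_aperiodic_pow hG.coeff_nonneg
  refine isEventuallyPeriodic_of_residues hD fun ρ _ => ?_
  refine isEventuallyPeriodic_hittingTimes_of_scaledBy (z := fun s => z (ρ + D * s))
    (fun i => ?_) hY
  refine (regular_of_aperiodic hΦ (hG.iterate hΦ D) (z := fun s => z (ρ + D * s)) (fun s => ?_)
    (fun s => hz _) hap i).1
  rw [mul_add, mul_one, ← add_assoc]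
  exact orbit_add hstep _ D

end Orbit

end Dynamics

/-! ### Floating-point rounding as a rounded system -/

section Floats

open Filter Topology Matrix

/-- Such sums cannot accumulate at `β` from below. In the induction, a new summand is either at most
half the old gap, or takes finitely many values `c j * y`, each with the gap for `β - c j * y`;
hence `β` must vary. -/
theorem exists_gap_sum {ι : Type*} {Φ : Set ℝ} (hΦ : IsScaleSet Φ) {c : ι → ℝ} (hc : ∀ j, 0 ≤ c j)
    (J : Finset ι) : ∀ β : ℝ, ∃ δ : ℝ, 0 < δ ∧ ∀ x : ι → ℝ, (∀ i, x i ∈ Φ) →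
      ∑ j ∈ J, c j * x j < β → ∑ j ∈ J, c j * x j ≤ β - δ := by
  classical
  induction J using Finset.induction_on with
  | empty =>
    intro β
    by_cases hβ : 0 < β
    · exact ⟨β, hβ, fun x _ _ => by simp⟩
    · exact ⟨1, one_pos, fun x _ h => absurd (by simpa using h) hβ⟩
  | insert j J hj ih =>
    intro β
    rcases (hc j).eq_or_lt with h0 | h0
    · obtain ⟨δ, hδ, h⟩ := ih β
      refine ⟨δ, hδ, fun x hx => ?_⟩
      rw [Finset.sum_insert hj, ← h0, zero_mul, zero_add]
      exact h x hx
    · choose δ hδ h using ih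
      have hfin := hΦ.finite (δ β / (2 * c j)) (β / c j) (by have := hδ β; positivity)
      have hev : ∀ᶠ η in 𝓝[>] (0 : ℝ), η ≤ δ β / 2 ∧
          ∀ y ∈ Φ ∩ Set.Icc (δ β / (2 * c j)) (β / c j), η ≤ δ (β - c j * y) := by
        refine Eventually.and ?_ ((eventually_all_finite hfin).2 fun y _ => ?_)
        · exact nhdsWithin_le_nhds (eventually_le_nhds (half_pos (hδ β)))
        · exact nhdsWithin_le_nhds (eventually_le_nhds (hδ _))
      obtain ⟨η, ⟨hη1, hη2⟩, hη⟩ := (hev.and self_mem_nhdsWithin).exists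
      refine ⟨η, hη, fun x hx hlt => ?_⟩
      rw [Finset.sum_insert hj] at hlt ⊢
      have hxj := hΦ.nonneg _ (hx j)
      have hmul := mul_nonneg h0.le hxj
      by_cases hsmall : x j < δ β / (2 * c j)
      · rw [lt_div_iff₀ (by positivity)] at hsmall
        have := h β x hx (by linarith)
        linarith
      · have hsum : 0 ≤ ∑ j ∈ J, c j * x j :=
          Finset.sum_nonneg fun l _ => mul_nonneg (hc l) (hΦ.nonneg _ (hx l))
        have hle : x j ≤ β / c j := by
          rw [le_div_iff₀ h0]
          linarith
        have h1 := hη2 (x j) ⟨hx j, not_lt.1 hsmall, hle⟩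
        have h2 := h (β - c j * x j) x hx (by linarith)
        linarith

/-- The non-negative floating-point numbers of precision `p`. -/
def nonnegFloats (p : ℕ) : Set ℝ := {y | IsFloatingPoint p y ∧ 0 ≤ y}

theorem zero_mem_nonnegFloats (p : ℕ) : (0 : ℝ) ∈ nonnegFloats p :=
  ⟨⟨0, 0, ⟨0, by simp⟩, Or.inl rfl, by simp⟩, le_rfl⟩

theorem isScaleSet_nonnegFloats (p : ℕ) : IsScaleSet (nonnegFloats p) where
  nonneg y hy := hy.2
  scale α y hy := by
    obtain ⟨⟨m, e, hk, hm, rfl⟩, hy⟩ := hy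
    refine ⟨⟨m, α + e, hk, hm, ?_⟩, by positivity⟩
    rw [zpow_add₀ (by norm_num)]
    ring
  finite a b ha := by
    obtain ⟨n₁, hn₁⟩ := exists_pow_lt_of_lt_one ha (by norm_num : (1 / 10 : ℝ) < 1)
    obtain ⟨n₂, hn₂⟩ := pow_unbounded_of_one_lt b (by norm_num : (1 : ℝ) < 10)
    refine (((Set.finite_Icc (-10 ^ p : ℤ) (10 ^ p)).prod
      (Set.finite_Icc (-n₁ : ℤ) (n₂ + 1))).image
        fun t : ℤ × ℤ => (t.1 : ℝ) / 10 ^ p * (10 : ℝ) ^ t.2).subset ?_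
    rintro y ⟨⟨⟨m, e, ⟨k, rfl⟩, hm, rfl⟩, -⟩, hya, hyb⟩
    have he : (0 : ℝ) < 10 ^ e := by positivity
    have hm0 : (k : ℝ) / 10 ^ p ≠ 0 := fun h => by rw [h, zero_mul] at hya; linarith
    obtain ⟨hm1, hm2⟩ := hm.resolve_left hm0
    have hmpos : 0 < (k : ℝ) / 10 ^ p := pos_of_mul_pos_left (ha.trans_le hya) he.le
    rw [abs_of_pos hmpos] at hm1 hm2
    have hp : (0 : ℝ) < 10 ^ p := by positivity
    refine ⟨(k, e), ⟨⟨?_, ?_⟩, ?_, ?_⟩, rfl⟩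
    · have : (0 : ℝ) < k := by
        by_contra! h
        linarith [div_nonpos_of_nonpos_of_nonneg h hp.le]
      have : (0 : ℤ) < k := by exact_mod_cast this
      have : (0 : ℤ) < 10 ^ p := by positivity
      dsimp only
      omega
    · rw [div_lt_one hp] at hm2
      exact_mod_cast hm2.le
    · have h1 : (10 : ℝ) ^ (-n₁ : ℤ) < 10 ^ e := by
        calc (10 : ℝ) ^ (-n₁ : ℤ) = (1 / 10) ^ n₁ := by simp
          _ < a := hn₁
          _ ≤ _ := hya
          _ ≤ 1 * 10 ^ e := mul_le_mul_of_nonneg_right hm2.le he.le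
          _ = _ := one_mul _
      exact ((zpow_lt_zpow_iff_right₀ (by norm_num)).1 h1).le
    · have h1 : (10 : ℝ) ^ (e - 1) < 10 ^ (n₂ : ℤ) := by
        calc (10 : ℝ) ^ (e - 1) = 1 / 10 * 10 ^ e := by
              rw [zpow_sub_one₀ (by norm_num)]; ring
          _ ≤ _ := mul_le_mul_of_nonneg_right hm1 he.le
          _ ≤ b := hyb
          _ < 10 ^ n₂ := hn₂
          _ = _ := by simp
      have := (zpow_lt_zpow_iff_right₀ (by norm_num : (1 : ℝ) < 10)).1 h1
      dsimp only
      omega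

theorem keepDigits_of_mem_Ico {w : ℝ} (h1 : 1 / 10 ≤ w) (h2 : w < 1) {n k : ℕ}
    (hk : (k : ℝ) / 10 ^ n ≤ w) (hk' : w < (k + 1) / 10 ^ n) :
    keepDigits n w = k / 10 ^ n := by
  have hw : 0 < w := by linarith
  have hlog : Int.log 10 w = -1 := by
    refine le_antisymm ?_ ?_
    · have := (Int.lt_zpow_iff_log_lt (b := 10) (x := 0) (by norm_num) hw).1 (by simpa using h2)
      omega
    · refine (Int.zpow_le_iff_le_log (b := 10) (by norm_num) hw).1 ?_
      norm_num at h1 ⊢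
      exact h1
  have hexp : decExponent w = 0 := by rw [decExponent, abs_of_pos hw, hlog]; norm_num
  have hp : (0 : ℝ) < 10 ^ n := by positivity
  have hfloor : ⌊w * 10 ^ n⌋ = (k : ℤ) := by
    rw [Int.floor_eq_iff]
    rw [div_le_iff₀ hp] at hk
    rw [lt_div_iff₀ hp] at hk'
    exact ⟨by exact_mod_cast hk, by exact_mod_cast hk'⟩
  rw [keepDigits, decMantissa, hexp, zpow_zero, div_one, abs_of_pos hw, hfloor, sign_pos hw]
  simp

section Rounding

variable {p : ℕ} {r : ℝ → ℝ}

theorem rounding_nonneg (hr : IsRounding p r) {y : ℝ} (hy : 0 ≤ y) : 0 ≤ r y := by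
  rw [← sign_nonneg_iff, hr.signPreserving, sign_nonneg_iff]
  exact hy

theorem rounding_mem (hr : IsRounding p r) {y : ℝ} (hy : 0 ≤ y) : r y ∈ nonnegFloats p :=
  ⟨hr.isFloatingPoint y, rounding_nonneg hr hy⟩

/-- The rounding of a non-negative combination of floating-point numbers is unchanged by a
relatively small increase. -/
theorem exists_rounding_add_eq (hr : IsRounding p r) {ι : Type*} [Fintype ι] {c : ι → ℝ}
    (hc : ∀ j, 0 ≤ c j) : ∃ ε : ℝ, 0 < ε ∧ ∀ x : ι → ℝ, (∀ i, x i ∈ nonnegFloats p) →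
      ∀ b, 0 ≤ b → b ≤ ε * ∑ j, c j * x j → r (∑ j, c j * x j + b) = r (∑ j, c j * x j) := by
  have hΦ := isScaleSet_nonnegFloats p
  choose δ hδ hgap using exists_gap_sum hΦ hc Finset.univ
  -- One gap serves all upper ends of truncation cells in `[0, 1)`. After scaling the sum into
  -- `[0.1, 1)`, an increase below this gap keeps the first `p + 1` digits.
  have hev : ∀ᶠ η in 𝓝[>] (0 : ℝ), ∀ k ∈ Finset.range (10 ^ (p + 1)),
      η ≤ δ (((k : ℕ) + 1 : ℝ) / 10 ^ (p + 1)) :=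
    (Finset.eventually_all _).2 fun k _ => nhdsWithin_le_nhds (eventually_le_nhds (hδ _))
  obtain ⟨η, hη, hη0⟩ := (hev.and self_mem_nhdsWithin).exists
  replace hη0 : 0 < η := hη0
  refine ⟨η / 2, half_pos hη0, fun x hx b hb hbε => ?_⟩
  set y := ∑ j, c j * x j with hy
  have hy0 : 0 ≤ y := Finset.sum_nonneg fun j _ => mul_nonneg (hc j) (hΦ.nonneg _ (hx j))
  rcases hy0.eq_or_lt with h0 | hy0
  · rw [← h0, mul_zero] at hbε
    rw [le_antisymm hbε hb, add_zero]
  set e := Int.log 10 y + 1 with he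
  have he0 : (0 : ℝ) < 10 ^ e := by positivity
  have hy1 : 1 / 10 ≤ (10 : ℝ) ^ (-e) * y := by
    have := Int.zpow_log_le_self (b := 10) (by norm_num) hy0
    rw [_root_.zpow_neg, ← div_eq_inv_mul, le_div_iff₀ he0, he, zpow_add₀ (by norm_num)]
    norm_num at this ⊢
    linarith
  have hy2 : (10 : ℝ) ^ (-e) * y < 1 := by
    have := Int.lt_zpow_succ_log_self (b := 10) (by norm_num) y
    rw [_root_.zpow_neg, ← div_eq_inv_mul, div_lt_one he0, he]
    exact_mod_cast this
  have hp : (0 : ℝ) < 10 ^ (p + 1) := by positivity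
  set y' := (10 : ℝ) ^ (-e) * y with hy'
  set k := ⌊y' * 10 ^ (p + 1)⌋₊ with hk
  have hk1 : (k : ℝ) / 10 ^ (p + 1) ≤ y' := by
    rw [div_le_iff₀ hp]
    exact Nat.floor_le (by positivity)
  have hk2 : y' < (k + 1) / 10 ^ (p + 1) := by
    rw [lt_div_iff₀ hp]
    exact Nat.lt_floor_add_one _
  have hk3 : k < 10 ^ (p + 1) := by
    have : (k : ℝ) < 10 ^ (p + 1) := by
      rw [div_le_iff₀ hp] at hk1
      nlinarith
    exact_mod_cast this
  have hk4 : ((k : ℝ) + 1) / 10 ^ (p + 1) ≤ 1 := by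
    rw [div_le_one hp]
    exact_mod_cast hk3
  have hsum : ∑ j, c j * ((10 : ℝ) ^ (-e) * x j) = y' := by
    rw [hy', hy, Finset.mul_sum]
    exact Finset.sum_congr rfl fun j _ => by ring
  have hgap' := hgap ((k + 1) / 10 ^ (p + 1)) (fun j => (10 : ℝ) ^ (-e) * x j)
    (fun j => hΦ.scale _ _ (hx j))
  rw [hsum] at hgap'
  have h1 := hgap' hk2
  have h2 := hη k (Finset.mem_range.2 hk3)
  have hb0 : 0 ≤ (10 : ℝ) ^ (-e) * b := by positivity
  have hb1 : (10 : ℝ) ^ (-e) * b ≤ η / 2 * y' := by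
    calc (10 : ℝ) ^ (-e) * b ≤ 10 ^ (-e) * (η / 2 * y) :=
          mul_le_mul_of_nonneg_left hbε (by positivity)
      _ = _ := by rw [hy']; ring
  have hb2 : η / 2 * y' < η := by nlinarith
  have hlt : y' + (10 : ℝ) ^ (-e) * b < (k + 1) / 10 ^ (p + 1) := by linarith
  have hkeep : r (y' + (10 : ℝ) ^ (-e) * b) = r y' := by
    refine hr.finite _ _ ?_
    rw [keepDigits_of_mem_Ico hy1 hy2 hk1 hk2,
      keepDigits_of_mem_Ico (by linarith) (by linarith) (by linarith) hlt]
  rw [hy', ← mul_add, hr.mantissaBased, hr.mantissaBased] at hkeep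
  exact mul_left_cancel₀ (by positivity) hkeep

/-- Digits are stable under small increases only, as a value may sit on the lower end of its cell.
So `x` and `x'` are both compared with their common part `w`, of which they are increases. -/
theorem roundedSystem_rounding (hr : IsRounding p r) {ι : Type*} [Fintype ι] {A : Matrix ι ι ℝ}
    (hA : ∀ i j, 0 ≤ A i j) :
    RoundedSystem (nonnegFloats p) A fun x i => r ((A *ᵥ x) i) where
  mem x hx i := rounding_mem hr (mulVec_nonneg hA (fun j => (hx j).2) i)
  coeff_nonneg := hA
  homog α x := by
    ext i
    rw [mulVec_smul, Pi.smul_apply, Pi.smul_apply, smul_eq_mul, smul_eq_mul, hr.mantissaBased]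
  bound := by
    obtain ⟨c, hc, h⟩ := hr.logBounded
    refine ⟨c, hc, fun x hx i => ?_⟩
    have h0 := mulVec_nonneg hA (fun j => (hx j).2) i
    obtain ⟨h1, h2⟩ := h ((A *ᵥ x) i)
    rw [abs_of_nonneg h0, abs_of_nonneg (rounding_nonneg hr h0)] at h1 h2
    rw [div_le_iff₀ hc, mul_comm] at h1
    exact ⟨h1, h2⟩
  stable := by
    classical
    choose ε hε h using fun i => exists_rounding_add_eq hr (hA i)
    have hev : ∀ᶠ η in 𝓝[>] (0 : ℝ), η ≤ 1 / 2 ∧ ∀ i, η ≤ ε i / 2 :=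
      Eventually.and (nhdsWithin_le_nhds (eventually_le_nhds (by norm_num)))
        (eventually_all.2 fun i => nhdsWithin_le_nhds (eventually_le_nhds (half_pos (hε i))))
    obtain ⟨η, ⟨hη1, hη2⟩, hη0⟩ := (hev.and self_mem_nhdsWithin).exists
    replace hη0 : 0 < η := hη0
    refine ⟨η, hη0, fun x x' v hx hx' hv hxv i hi => ?_⟩
    set w : ι → ℝ := fun j => if x j = x' j then x j else 0 with hw
    have hwΦ : ∀ j, w j ∈ nonnegFloats p := by
      intro j
      simp only [hw]
      split_ifs
      · exact hx j
      · exact zero_mem_nonnegFloats p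
    have hbounds : ∀ j, (0 ≤ (x - w) j ∧ (x - w) j ≤ v j) ∧
        (0 ≤ (x' - w) j ∧ (x' - w) j ≤ v j) := by
      intro j
      simp only [Pi.sub_apply, hw]
      split_ifs with he
      · rw [← he]
        simp [hv j]
      · obtain ⟨h1, h2⟩ := (hxv j).resolve_left he
        simp only [sub_zero]
        exact ⟨⟨(hx j).2, h1⟩, (hx' j).2, h2⟩
    have hAv := mulVec_nonneg hA hv i
    have hAw := mulVec_nonneg hA (fun j => (hwΦ j).2) i
    have hsplit : ∀ u : ι → ℝ, (A *ᵥ u) i = (A *ᵥ w) i + (A *ᵥ (u - w)) i := by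
      intro u
      rw [← Pi.add_apply, ← mulVec_add, add_sub_cancel]
    have hle : (A *ᵥ (x - w)) i ≤ (A *ᵥ v) i := mulVec_le_mulVec hA (fun j => (hbounds j).1.2) i
    have hle' : (A *ᵥ (x' - w)) i ≤ (A *ᵥ v) i := mulVec_le_mulVec hA (fun j => (hbounds j).2.2) i
    -- `hi` measures `v` against `x`, not `w`; the difference contributes at most `1 / 2 * (A *ᵥ v)
    -- i`, which is absorbed on the left.
    have hsmall : (A *ᵥ v) i ≤ ε i * (A *ᵥ w) i := by
      rw [hsplit x] at hi
      have h1 : η * ((A *ᵥ w) i + (A *ᵥ (x - w)) i) ≤ η * (A *ᵥ w) i + 1 / 2 * (A *ᵥ v) i := by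
        rw [mul_add]
        have := mulVec_nonneg hA (fun j => (hbounds j).1.1) i
        gcongr
      have h2 : η * (A *ᵥ w) i ≤ ε i / 2 * (A *ᵥ w) i := by
        gcongr
        exact hη2 i
      linarith
    have key : ∀ u : ι → ℝ, 0 ≤ (A *ᵥ (u - w)) i → (A *ᵥ (u - w)) i ≤ (A *ᵥ v) i →
        r ((A *ᵥ u) i) = r ((A *ᵥ w) i) := by
      intro u h1 h2
      rw [hsplit u]
      exact h i w hwΦ _ h1 (h2.trans hsmall)
    exact (key x (mulVec_nonneg hA (fun j => (hbounds j).1.1) i) hle).trans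
      (key x' (mulVec_nonneg hA (fun j => (hbounds j).2.1) i) hle').symm

end Rounding

end Floats

end RoundedLDS

theorem theorem4 (p : ℕ) (r : ℝ → ℝ) (hr : IsRounding p r) (d : ℕ)
    (M : Matrix (Fin d) (Fin d) ℚ) (x : Fin d → ℚ)
    (hM : ∀ i j, 0 ≤ M i j) (hx : ∀ i, 0 ≤ x i)
    (Y : Set (Fin d → ℝ)) (hY : IsSemialgebraic Y) :
    IsSemilinear (hittingTimes (roundedOrbit r M x) Y) ∧
      IsEventuallyPeriodic (hittingTimes (roundedOrbit r M x) Y) := by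
  have hG := RoundedLDS.roundedSystem_rounding hr (A := M.map ((↑) : ℚ → ℝ))
    fun i j => by simpa using hM i j
  have hmem : ∀ s i, roundedOrbit r M x s i ∈ RoundedLDS.nonnegFloats p := by
    intro s
    induction s with
    | zero => exact fun i => RoundedLDS.rounding_mem hr (by exact_mod_cast hx i)
    | succ s ih => exact hG.mem _ ih
  have h := RoundedLDS.isEventuallyPeriodic_hittingTimes_of_roundedSystem
    (RoundedLDS.isScaleSet_nonnegFloats p) hG (fun _ => rfl) hmem hY
  exact ⟨RoundedLDS.isSemilinear_of_isEventuallyPeriodic h, h⟩
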